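/- Let $1\le r<d<n$ be integers with $n\ge 3$, and let $V$ be an $n$-dimensional real or complex Hilbert space. Write $\mathbb{G}(r,V)$ for the set of $r$-dimensional linear subspaces of $V$ ("$r$-planes") and $\mathbb{G}(\le r,V)$ for the set of linear subspaces of $V$ of dimension at most $r$ (including $\{0\}$), and let $P_\pi$ denote the orthogonal projection of $V$ onto a subspace $\pi$. For $\zeta,\zeta',\zeta''\in\mathbb{G}(r,V)$ write $\tau_d(\zeta,\zeta'\mid\zeta'')$ if there is a $d$-plane $\pi\supseteq\zeta$ with $\zeta''=P_\pi\zeta'$. A subset $S\subseteq\mathbb{G}(r,V)$ is $\tau_d$-saturated if for all $\zeta,\zeta'\in S$ and all $\zeta''\in\mathbb{G}(r,V)$, $\tau_d(\zeta,\zeta'\mid\zeta'')$ implies $\zeta''\in S$. For a subspace $\pi\le V$ let $\pi^{\uparrow}=\{\pi'\in\mathbb{G}(r,V):\pi'\supseteq\pi\}$ be its $r$-spine, and let $\bigcap S$ denote the intersection of all members of $S$ (with $\bigcap\emptyset=V$). Then the following conditions are equivalent: (a) $2r\le d$; (b) every $\tau_d$-saturated subset $S\subseteq\mathbb{G}(r,V)$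 satisfies $S=\left(\bigcap S\right)^{\uparrow}$; (c) $\mathbb{G}(r,V)$ has no $\tau_d$-saturated subset with exactly two elements. Moreover, (b) implies (hence, so do (a) and (c)) that $\pi\mapsto\pi^{\uparrow}$ is a bijection from $\mathbb{G}(\le r,V)$ onto the collection of non-empty $\tau_d$-saturated subsets of $\mathbb{G}(r,V)$. -/

import Mathlib

open Module

namespace GrassmannianSpines

variable {𝕜 V : Type*} [RCLike 𝕜] [NormedAddCommGroup V] [InnerProductSpace 𝕜 V]

variable (𝕜 V) in
/-- The Grassmannian `G(r, V)` of `r`-dimensional linear subspaces of `V`. -/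
def grassmannian (r : ℕ) : Set (Submodule 𝕜 V) :=
  {W | finrank 𝕜 W = r}

variable (𝕜 V) in
/-- `G(≤ r, V)`: the linear subspaces of `V` of dimension at most `r`, zero included. -/
def grassmannianLE (r : ℕ) : Set (Submodule 𝕜 V) :=
  {W | finrank 𝕜 W ≤ r}

/-- The spine `π^↑`: the set of all `r`-planes containing `π`. -/
def spine (r : ℕ) (π : Submodule 𝕜 V) : Set (Submodule 𝕜 V) :=
  {W | W ∈ grassmannian 𝕜 V r ∧ π ≤ W}

variable [FiniteDimensional 𝕜 V]

/-- The ternary relation `τ_d(ζ, ζ' | ζ'')`: there is a `d`-plane `π` containing `ζ` such that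
`ζ''` is the image of `ζ'` under the orthogonal projection onto `π`. -/
def Tau (d : ℕ) (ζ ζ' ζ'' : Submodule 𝕜 V) : Prop :=
  ∃ π ∈ grassmannian 𝕜 V d, ζ ≤ π ∧ ζ'' = ζ'.map (π.starProjection : V →ₗ[𝕜] V)

/-- `S` is a `τ_d`-saturated subset of `G(r, V)`. -/
def IsSaturated (r d : ℕ) (S : Set (Submodule 𝕜 V)) : Prop :=
  S ⊆ grassmannian 𝕜 V r ∧
    ∀ ζ ∈ S, ∀ ζ' ∈ S, ∀ ζ'' ∈ grassmannian 𝕜 V r, Tau d ζ ζ' ζ'' → ζ'' ∈ S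

end GrassmannianSpines

/-! For `d < 2r`, choose distinct `r`-planes `ζ, ζ'` with `ζ'` comparable to `ζᗮ`. For every
`d`-plane `π ⊇ ζ` the kernel `πᗮ` meets `ζ'` nontrivially, and symmetrically, so mixed pairs yield
no `r`-plane and `{ζ, ζ'}` is saturated. Spines never have exactly two elements, so (b) excludes
this.

For `2r ≤ d` there is room to project along any single vector `u ⟂ ζ`, `u ∉ ζ'`
(`IsSaturated.map_mem`). The `r`-planes through an `(r-1)`-plane `H` are the lines of `Hᗮ`, of
dimension at least 3, and those in `S` form a projection-closed set. Two of them generate all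
(`IsProjectionClosed.mem_of_notMem_span`): Thales circles give ever wider angles until a right angle
appears, and from a right angle every line is reached. So adjacent members of `S` force the whole
spine of `H`. Finally, a minimal `π` whose spine lies in `S` is contained in every member of `S`
(`IsSaturated.exists_lt_spine_subset`), whence `S` is the spine of its intersection. -/

namespace GrassmannianSpines

open Submodule
open scoped InnerProductSpace

/-- A subspace not contained in either of two others has a vector outside both. -/
theorem exists_mem_notMem_notMem {K M : Type*} [Ring K] [AddCommGroup M] [Module K M]
    {A p q : Submodule K M} (hp : ¬ A ≤ p) (hq : ¬ A ≤ q) : ∃ u ∈ A, u ∉ p ∧ u ∉ q := by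
  obtain ⟨a, haA, hap⟩ := SetLike.not_le_iff_exists.1 hp
  obtain ⟨b, hbA, hbq⟩ := SetLike.not_le_iff_exists.1 hq
  by_cases haq : a ∈ q
  · by_cases hbp : b ∈ p
    · exact ⟨a + b, A.add_mem haA hbA, fun h => hap ((p.add_mem_iff_left hbp).1 h),
        fun h => hbq ((q.add_mem_iff_right haq).1 h)⟩
    · exact ⟨b, hbA, hbp, hbq⟩
  · exact ⟨a, haA, hap, haq⟩

theorem exists_between_finrank_eq {K M : Type*} [Field K] [AddCommGroup M] [Module K M]
    [FiniteDimensional K M] {A B : Submodule K M} (hAB : A ≤ B) {m : ℕ}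
    (hA : finrank K A ≤ m) (hB : m ≤ finrank K B) :
    ∃ W : Submodule K M, A ≤ W ∧ W ≤ B ∧ finrank K W = m := by
  induction m, hA using Nat.le_induction with
  | base => exact ⟨A, le_rfl, hAB, rfl⟩
  | succ m _ ih =>
    obtain ⟨W, hAW, hWB, hW⟩ := ih (by omega)
    have : ¬ B ≤ W := fun h => by
      have := Submodule.finrank_mono h
      omega
    obtain ⟨v, hvB, hvW⟩ := SetLike.not_le_iff_exists.1 this
    exact ⟨W ⊔ K ∙ v, hAW.trans le_sup_left,
      sup_le hWB ((span_singleton_le_iff_mem _ _).2 hvB),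
      by rw [finrank_sup_span_singleton hvW, hW]⟩

/-! ### Projection-closed sets of vectors. -/

variable {𝕜 E : Type*} [RCLike 𝕜] [NormedAddCommGroup E] [InnerProductSpace 𝕜 E]

theorem exists_mem_orthogonal_inner_ne_zero [FiniteDimensional 𝕜 E] {W : Submodule 𝕜 E} {v : E}
    (hv : v ∉ W) : ∃ f ∈ Wᗮ, ⟪f, v⟫_𝕜 ≠ 0 := by
  by_contra! h
  apply hv
  rw [← W.orthogonal_orthogonal, mem_orthogonal]
  exact h

theorem exists_ne_zero_inner_eq_zero [FiniteDimensional 𝕜 E] (hE : 3 ≤ finrank 𝕜 E) (a b : E) :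
    ∃ f : E, f ≠ 0 ∧ ⟪a, f⟫_𝕜 = 0 ∧ ⟪b, f⟫_𝕜 = 0 := by
  classical
  have h1 := (span 𝕜 ((({a, b} : Finset E)) : Set E)).finrank_add_finrank_orthogonal
  have h2 : finrank 𝕜 (span 𝕜 ((({a, b} : Finset E)) : Set E)) ≤ 2 :=
    (finrank_span_finset_le_card _).trans Finset.card_le_two
  have h3 : (span 𝕜 ((({a, b} : Finset E)) : Set E))ᗮ ≠ ⊥ := fun h => by
    rw [h, finrank_bot] at h1
    omega
  obtain ⟨f, hf, hf0⟩ := exists_mem_ne_zero_of_ne_bot h3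
  rw [mem_orthogonal] at hf
  exact ⟨f, hf0, hf a (subset_span (by simp)), hf b (subset_span (by simp))⟩

/-- A set of vectors of an inner product space that is closed under nonzero scaling and under
the nonzero images of `b` by the orthogonal projections along the vectors orthogonal to `a`. -/
structure IsProjectionClosed (𝕜 : Type*) {E : Type*} [RCLike 𝕜] [NormedAddCommGroup E]
    [InnerProductSpace 𝕜 E] (L : Set E) : Prop where
  smul_mem : ∀ c : 𝕜, c ≠ 0 → ∀ v ∈ L, c • v ∈ L
  proj_mem : ∀ a ∈ L, ∀ b ∈ L, ∀ c : E, c ≠ 0 → ⟪a, b - c⟫_𝕜 = 0 → ⟪c, b - c⟫_𝕜 = 0 → c ∈ L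

namespace IsProjectionClosed

theorem mem_of_smul_mem {L : Set E} (hL : IsProjectionClosed 𝕜 L) {c : 𝕜} {v : E} (hc : c ≠ 0)
    (h : c • v ∈ L) : v ∈ L := by
  simpa [smul_smul, hc] using hL.smul_mem c⁻¹ (inv_ne_zero hc) _ h

/-- The projection of `b` to the line of `v` is a nonzero multiple of `v`, and the residual is
orthogonal to `a` because `b` and `v` are. -/
theorem mem_of_inner_ne_zero {L : Set E} (hL : IsProjectionClosed 𝕜 L) {a b v : E} (ha : a ∈ L)
    (hb : b ∈ L) (hab : ⟪a, b⟫_𝕜 = 0) (hav : ⟪a, v⟫_𝕜 = 0) (hvb : ⟪v, b⟫_𝕜 ≠ 0) : v ∈ L := by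
  have hv0 : v ≠ 0 := by rintro rfl; simp at hvb
  have hvv : ⟪v, v⟫_𝕜 ≠ 0 := inner_self_ne_zero.2 hv0
  have ht : ⟪v, b⟫_𝕜 / ⟪v, v⟫_𝕜 ≠ 0 := div_ne_zero hvb hvv
  refine hL.mem_of_smul_mem ht (hL.proj_mem a ha b hb _ (smul_ne_zero ht hv0) ?_ ?_)
  · rw [inner_sub_right, inner_smul_right, hab, hav]; simp
  · rw [inner_smul_left, inner_sub_right, inner_smul_right, div_mul_cancel₀ _ hvv, sub_self,
      mul_zero]

/-- When `v ⟂ b`, a detour through `v + b`, orthogonal to neither, reaches `v`. -/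
theorem mem_of_inner_eq_zero {L : Set E} (hL : IsProjectionClosed 𝕜 L) {a b v : E} (ha : a ∈ L)
    (hb : b ∈ L) (hb0 : b ≠ 0) (hab : ⟪a, b⟫_𝕜 = 0) (hav : ⟪a, v⟫_𝕜 = 0) (hv0 : v ≠ 0) :
    v ∈ L := by
  by_cases hvb : ⟪v, b⟫_𝕜 = 0
  · have hbv : ⟪b, v⟫_𝕜 = 0 := inner_eq_zero_symm.1 hvb
    have h1 : v + b ∈ L := hL.mem_of_inner_ne_zero ha hb hab
      (by rw [inner_add_right, hav, hab, add_zero])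
      (by rw [inner_add_left, hvb, zero_add]; exact inner_self_ne_zero.2 hb0)
    exact hL.mem_of_inner_ne_zero ha h1 (by rw [inner_add_right, hav, hab, add_zero]) hav
      (by rw [inner_add_right, hvb, add_zero]; exact inner_self_ne_zero.2 hv0)
  · exact hL.mem_of_inner_ne_zero ha hb hab hav hvb

/-- A third direction `c ⟂ a, v` is reached from `(a, b)`; the orthogonal pair `(c, a)` then reaches
`v`. -/
theorem mem_of_orthogonal_pair [FiniteDimensional 𝕜 E] (hE : 3 ≤ finrank 𝕜 E) {L : Set E}
    (hL : IsProjectionClosed 𝕜 L) {a b v : E} (ha : a ∈ L) (ha0 : a ≠ 0)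
    (hb : b ∈ L) (hb0 : b ≠ 0) (hab : ⟪a, b⟫_𝕜 = 0) (hv0 : v ≠ 0) : v ∈ L := by
  obtain ⟨c, hc0, hac, hvc⟩ := exists_ne_zero_inner_eq_zero (𝕜 := 𝕜) hE a v
  have hc : c ∈ L := hL.mem_of_inner_eq_zero ha hb hb0 hab hac hc0
  exact hL.mem_of_inner_eq_zero hc ha ha0 (inner_eq_zero_symm.1 hac) (inner_eq_zero_symm.1 hvc) hv0

/-- `L` contains vectors `a` and `b` with `⟪a, b⟫ = 1`, the squared tangent of whose angle
is `σ`. -/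
def HasPair (𝕜 : Type*) {E : Type*} [RCLike 𝕜] [NormedAddCommGroup E]
    [InnerProductSpace 𝕜 E] (L : Set E) (σ : ℝ) : Prop :=
  ∃ a ∈ L, ∃ b ∈ L, ⟪a, b⟫_𝕜 = 1 ∧ ‖a‖ ^ 2 * ‖b‖ ^ 2 = 1 + σ

/-- From a pair in `L` one obtains an orthogonal frame `a, w, f` such that `L` contains all
`a + w'` with `w'` on a circle with diameter `w`. -/
theorem exists_frame [FiniteDimensional 𝕜 E] (hE : 3 ≤ finrank 𝕜 E) {L : Set E}
    (hL : IsProjectionClosed 𝕜 L) {σ : ℝ} (h : HasPair 𝕜 L σ) :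
    ∃ a w f : E, ⟪a, a⟫_𝕜 = 1 ∧ ⟪w, w⟫_𝕜 = σ ∧ ⟪f, f⟫_𝕜 = σ ∧ ⟪a, w⟫_𝕜 = 0 ∧ ⟪a, f⟫_𝕜 = 0 ∧
      ⟪w, f⟫_𝕜 = 0 ∧
      ∀ x y : ℝ, x ^ 2 + y ^ 2 = x → a + (x : 𝕜) • w + (y : 𝕜) • f ∈ L := by
  obtain ⟨a₀, ha₀, b₀, hb₀, hab, hσ⟩ := h
  have ha0 : a₀ ≠ 0 := by rintro rfl; simp at hab
  have hn : (‖a₀‖ : 𝕜) ≠ 0 := by simpa using ha0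
  obtain ⟨a, ha⟩ : ∃ a, a = (‖a₀‖ : 𝕜)⁻¹ • a₀ := ⟨_, rfl⟩
  obtain ⟨b, hb⟩ : ∃ b, b = (‖a₀‖ : 𝕜) • b₀ := ⟨_, rfl⟩
  have haL : a ∈ L := ha ▸ hL.smul_mem _ (inv_ne_zero hn) _ ha₀
  have hbL : b ∈ L := hb ▸ hL.smul_mem _ hn _ hb₀
  have haa : ⟪a, a⟫_𝕜 = 1 := by
    rw [ha, inner_smul_left, inner_smul_right, inner_self_eq_norm_sq_to_K]
    simp only [map_inv₀, RCLike.conj_ofReal]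
    field_simp
  have hab1 : ⟪a, b⟫_𝕜 = 1 := by
    rw [ha, hb, inner_smul_left, inner_smul_right, hab]
    simp only [map_inv₀, RCLike.conj_ofReal]
    field_simp
  have hbb : ⟪b, b⟫_𝕜 = 1 + (σ : 𝕜) := by
    rw [hb, inner_smul_left, inner_smul_right, inner_self_eq_norm_sq_to_K, RCLike.conj_ofReal]
    have : ((‖a₀‖ ^ 2 * ‖b₀‖ ^ 2 : ℝ) : 𝕜) = ((1 + σ : ℝ) : 𝕜) := by rw [hσ]
    push_cast at this
    rw [← this]; ring
  have hba1 : ⟪b, a⟫_𝕜 = 1 := by rw [← inner_conj_symm, hab1, map_one]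
  obtain ⟨w, hw⟩ : ∃ w, w = b - a := ⟨_, rfl⟩
  have haw : ⟪a, w⟫_𝕜 = 0 := by rw [hw, inner_sub_right, hab1, haa, sub_self]
  have hww : ⟪w, w⟫_𝕜 = σ := by
    rw [hw, inner_sub_right, inner_sub_left, inner_sub_left, hbb, hab1, haa, hba1]; ring
  have hwσ : ‖w‖ ^ 2 = σ := by
    rw [inner_self_eq_norm_sq_to_K] at hww
    exact_mod_cast hww
  obtain ⟨f₀, hf0, haf, hwf⟩ := exists_ne_zero_inner_eq_zero (𝕜 := 𝕜) hE a w
  have hfn : (‖f₀‖ : 𝕜) ≠ 0 := by simpa using hf0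
  obtain ⟨f, hf⟩ : ∃ f, f = ((‖w‖ : 𝕜) / (‖f₀‖ : 𝕜)) • f₀ := ⟨_, rfl⟩
  have haf : ⟪a, f⟫_𝕜 = 0 := by rw [hf, inner_smul_right, haf, mul_zero]
  have hwf : ⟪w, f⟫_𝕜 = 0 := by rw [hf, inner_smul_right, hwf, mul_zero]
  have hff : ⟪f, f⟫_𝕜 = σ := by
    rw [hf, inner_smul_left, inner_smul_right, inner_self_eq_norm_sq_to_K, ← hwσ]
    simp only [map_div₀, RCLike.conj_ofReal]
    push_cast
    field_simp
  refine ⟨a, w, f, haa, hww, hff, haw, haf, hwf, fun x y hxy => ?_⟩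
  have hfw : ⟪f, w⟫_𝕜 = 0 := inner_eq_zero_symm.1 hwf
  have hxy' : (x : 𝕜) ^ 2 + (y : 𝕜) ^ 2 = x := by exact_mod_cast hxy
  have hb' : b = a + w := by rw [hw]; abel
  -- Thales: `x² + y² = x` makes `xw + yf` orthogonal to `w - (xw + yf)`.
  refine hL.proj_mem a haL b hbL _ ?_ ?_ ?_
  · intro h0
    have := congrArg (fun z => ⟪a, z⟫_𝕜) h0
    simp [inner_add_right, inner_smul_right, haw, haf] at this
    simp [this] at haa
  · simp only [inner_sub_right, inner_add_right, inner_smul_right, haw, haf, haa, hab1]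
    simp
  · rw [hb']
    simp only [inner_sub_right, inner_add_right, inner_add_left, inner_smul_left,
      inner_smul_right, haw, haf, haa, hwf, hww, hff, hfw, inner_eq_zero_symm.1 haw,
      inner_eq_zero_symm.1 haf, RCLike.conj_ofReal]
    linear_combination -(σ : 𝕜) * hxy'

/-- The ends of the circle's diameter perpendicular to `w` have inner product 1 and squared norms `1
+ σ/2`. -/
theorem hasPair_add [FiniteDimensional 𝕜 E] (hE : 3 ≤ finrank 𝕜 E) {L : Set E}
    (hL : IsProjectionClosed 𝕜 L) {σ : ℝ} (h : HasPair 𝕜 L σ) :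
    HasPair 𝕜 L (σ + σ ^ 2 / 4) := by
  obtain ⟨a, w, f, haa, hww, hff, haw, haf, hwf, hmem⟩ := hL.exists_frame hE h
  have hfw : ⟪f, w⟫_𝕜 = 0 := inner_eq_zero_symm.1 hwf
  have key : ∀ x y z : ℝ, ⟪a + (x : 𝕜) • w + (y : 𝕜) • f, a + (x : 𝕜) • w + (z : 𝕜) • f⟫_𝕜 =
      ((1 + (x ^ 2 + y * z) * σ : ℝ) : 𝕜) := by
    intro x y z
    simp only [inner_add_right, inner_add_left, inner_smul_left,
      inner_smul_right, haw, haf, haa, hwf, hww, hff, hfw, inner_eq_zero_symm.1 haw,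
      inner_eq_zero_symm.1 haf, RCLike.conj_ofReal]
    push_cast
    ring
  have norm : ∀ x y : ℝ, ‖a + (x : 𝕜) • w + (y : 𝕜) • f‖ ^ 2 = 1 + (x ^ 2 + y * y) * σ := by
    intro x y
    have := key x y y
    rw [inner_self_eq_norm_sq_to_K] at this
    exact_mod_cast this
  refine ⟨_, hmem (1 / 2) (1 / 2) (by norm_num), _, hmem (1 / 2) (-(1 / 2)) (by norm_num), ?_, ?_⟩
  · rw [key]; norm_num
  · rw [norm, norm]; ring

theorem mem_of_hasPair_of_le [FiniteDimensional 𝕜 E] (hE : 3 ≤ finrank 𝕜 E) {L : Set E}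
    (hL : IsProjectionClosed 𝕜 L) {σ : ℝ} (h : HasPair 𝕜 L σ) (hσ : 8 ≤ σ) {v : E}
    (hv0 : v ≠ 0) : v ∈ L := by
  obtain ⟨a, w, f, haa, hww, hff, haw, haf, hwf, hmem⟩ := hL.exists_frame hE h
  have hfw : ⟪f, w⟫_𝕜 = 0 := inner_eq_zero_symm.1 hwf
  have hne : ∀ x y : ℝ, a + (x : 𝕜) • w + (y : 𝕜) • f ≠ 0 := by
    intro x y h0
    have := congrArg (fun z => ⟪a, z⟫_𝕜) h0
    simp [inner_add_right, inner_smul_right, haw, haf] at this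
    simp [this] at haa
  -- The circle points `(x, ±y)` are orthogonal when `2x² - x + 1/σ = 0`; this has a real root
  -- exactly because `σ ≥ 8`.
  have hσ1 : 0 ≤ 1 - 8 / σ := by
    rw [sub_nonneg, div_le_one (by linarith)]; exact hσ
  have hσ2 : 8 / σ ≥ 0 := by positivity
  obtain ⟨s, hs⟩ : ∃ s, s = √(1 - 8 / σ) := ⟨_, rfl⟩
  have hs2 : s ^ 2 = 1 - 8 / σ := by rw [hs, Real.sq_sqrt hσ1]
  have hs0 : 0 ≤ s := hs ▸ Real.sqrt_nonneg _
  have hs1 : s ≤ 1 := by nlinarith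
  obtain ⟨x, hx⟩ : ∃ x, x = (1 + s) / 4 := ⟨_, rfl⟩
  have hx2 : 0 ≤ x - x ^ 2 := by rw [hx]; nlinarith
  obtain ⟨y, hy⟩ : ∃ y, y = √(x - x ^ 2) := ⟨_, rfl⟩
  have hy2 : y ^ 2 = x - x ^ 2 := by rw [hy, Real.sq_sqrt hx2]
  refine hL.mem_of_orthogonal_pair hE (hmem x y (by linarith)) (hne _ _)
    (hmem x (-y) (by linarith [neg_sq y])) (hne _ _) ?_ hv0
  have hreal : 1 + (x ^ 2 - y ^ 2) * σ = 0 := by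
    have : (8 / σ) * σ = 8 := div_mul_cancel₀ _ (by linarith)
    rw [hy2, hx]
    linear_combination (σ / 8) * hs2 - this / 8
  have hK : (1 : 𝕜) + ((x : 𝕜) ^ 2 - (y : 𝕜) ^ 2) * σ = 0 := by exact_mod_cast hreal
  simp only [inner_add_right, inner_add_left, inner_smul_left,
      inner_smul_right, haw, haf, haa, hwf, hww, hff, hfw, inner_eq_zero_symm.1 haw,
      inner_eq_zero_symm.1 haf, RCLike.conj_ofReal]
  push_cast
  linear_combination hK

/-- Each widening adds at least the initial `σ²/4`, so growth is unbounded. -/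
theorem exists_hasPair_ge [FiniteDimensional 𝕜 E] (hE : 3 ≤ finrank 𝕜 E) {L : Set E}
    (hL : IsProjectionClosed 𝕜 L) {σ : ℝ} (h : HasPair 𝕜 L σ) (hσ : 0 < σ) (N : ℕ) :
    ∃ τ, σ + N * (σ ^ 2 / 4) ≤ τ ∧ HasPair 𝕜 L τ := by
  induction N with
  | zero => exact ⟨σ, by simp, h⟩
  | succ N ih =>
    obtain ⟨τ, hτ, hp⟩ := ih
    refine ⟨_, ?_, hL.hasPair_add hE hp⟩
    have h1 : σ ≤ τ := le_trans (le_add_of_nonneg_right (by positivity)) hτ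
    have h2 : σ ^ 2 ≤ τ ^ 2 := by gcongr
    push_cast
    linarith

/-- In dimension at least three, a projection-closed set containing two non-proportional vectors
contains every nonzero vector. -/
theorem mem_of_notMem_span [FiniteDimensional 𝕜 E] (hE : 3 ≤ finrank 𝕜 E) {L : Set E}
    (hL : IsProjectionClosed 𝕜 L) {a b v : E} (ha : a ∈ L) (ha0 : a ≠ 0) (hb : b ∈ L)
    (hab : b ∉ 𝕜 ∙ a) (hv0 : v ≠ 0) : v ∈ L := by
  have hb0 : b ≠ 0 := fun h => hab (h ▸ zero_mem _)
  by_cases h : ⟪a, b⟫_𝕜 = 0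
  · exact hL.mem_of_orthogonal_pair hE ha ha0 hb hb0 h hv0
  obtain ⟨b', hb'⟩ : ∃ b', b' = (⟪a, b⟫_𝕜)⁻¹ • b := ⟨_, rfl⟩
  have hb'L : b' ∈ L := hb' ▸ hL.smul_mem _ (inv_ne_zero h) _ hb
  have hab' : ⟪a, b'⟫_𝕜 = 1 := by rw [hb', inner_smul_right, inv_mul_cancel₀ h]
  have hlt : 1 < ‖a‖ * ‖b'‖ := by
    have h1 : ‖⟪a, b'⟫_𝕜‖ ≤ ‖a‖ * ‖b'‖ := norm_inner_le_norm a b'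
    rw [hab', norm_one] at h1
    refine lt_of_le_of_ne h1 fun he => ?_
    have hb'0 : b' ≠ 0 := by rw [hb']; exact smul_ne_zero (inv_ne_zero h) hb0
    have := (norm_inner_eq_norm_iff (𝕜 := 𝕜) ha0 hb'0).1 (by rw [hab', norm_one, he])
    obtain ⟨r, -, hr⟩ := this
    apply hab
    rw [mem_span_singleton]
    refine ⟨⟪a, b⟫_𝕜 * r, ?_⟩
    rw [mul_smul, ← hr, hb', smul_smul, mul_inv_cancel₀ h, one_smul]
  have hσ : 0 < ‖a‖ ^ 2 * ‖b'‖ ^ 2 - 1 := by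
    rw [← mul_pow]
    nlinarith
  obtain ⟨σ, hσe⟩ : ∃ σ, σ = ‖a‖ ^ 2 * ‖b'‖ ^ 2 - 1 := ⟨_, rfl⟩
  rw [← hσe] at hσ
  have hp : HasPair 𝕜 L σ := ⟨a, ha, b', hb'L, hab', by rw [hσe]; ring⟩
  obtain ⟨N, hN⟩ := exists_nat_ge (8 / (σ ^ 2 / 4))
  rw [div_le_iff₀ (by positivity)] at hN
  obtain ⟨τ, hτ, hpτ⟩ := hL.exists_hasPair_ge hE hp hσ N
  exact hL.mem_of_hasPair_of_le hE hpτ (by linarith) hv0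

end IsProjectionClosed
-- Projected subspaces and saturated sets for `2r ≤ d`.
variable {𝕜 V : Type*} [RCLike 𝕜] [NormedAddCommGroup V] [InnerProductSpace 𝕜 V]
variable [FiniteDimensional 𝕜 V]

theorem sub_starProjection_orthogonal_mem (U : Submodule 𝕜 V) (x : V) :
    x - Uᗮ.starProjection x ∈ U := by
  simp

theorem map_starProjection_eq_of_le {W U : Submodule 𝕜 V} (h : W ≤ U) :
    W.map (U.starProjection : V →ₗ[𝕜] V) = W := by
  have h1 : ∀ x ∈ W, U.starProjection x = x := fun x hx => starProjection_eq_self_iff.2 (h hx)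
  ext y
  constructor
  · rintro ⟨x, hx, rfl⟩
    simpa [h1 x hx] using hx
  · exact fun hy => ⟨y, hy, h1 y hy⟩

theorem finrank_map_starProjection_of_disjoint {W U : Submodule 𝕜 V}
    (h : ∀ x ∈ W, x ∈ Uᗮ → x = 0) :
    finrank 𝕜 (W.map (U.starProjection : V →ₗ[𝕜] V)) = finrank 𝕜 W := by
  rw [← LinearMap.range_domRestrict]
  apply LinearMap.finrank_range_of_inj
  rw [← LinearMap.ker_eq_bot, LinearMap.ker_eq_bot']
  rintro ⟨x, hx⟩ h0
  exact Subtype.ext (h x hx ((starProjection_apply_eq_zero_iff _).1 h0))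

theorem finrank_map_starProjection_lt {W U : Submodule 𝕜 V} (h : W ⊓ Uᗮ ≠ ⊥) :
    finrank 𝕜 (W.map (U.starProjection : V →ₗ[𝕜] V)) < finrank 𝕜 W := by
  obtain ⟨x, hx, hx0⟩ := exists_mem_ne_zero_of_ne_bot h
  rw [← LinearMap.range_domRestrict]
  have h1 := LinearMap.finrank_range_add_finrank_ker
    ((U.starProjection : V →ₗ[𝕜] V).domRestrict W)
  have h2 : LinearMap.ker ((U.starProjection : V →ₗ[𝕜] V).domRestrict W) ≠ ⊥ := fun h =>
    hx0 (congrArg Subtype.val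
      (LinearMap.ker_eq_bot'.1 h ⟨x, hx.1⟩ ((starProjection_apply_eq_zero_iff _).2 hx.2)))
  have h3 := Submodule.one_le_finrank_iff.2 h2
  omega

namespace IsSaturated

/-- If `2r ≤ d`, a saturated set is closed under projections along single vectors. -/
theorem map_mem {r d : ℕ} {S : Set (Submodule 𝕜 V)} (hS : IsSaturated r d S)
    (h2 : 2 * r ≤ d) (hd : d < finrank 𝕜 V) {ζ ζ' : Submodule 𝕜 V} (hζ : ζ ∈ S) (hζ' : ζ' ∈ S)
    {u : V} (hu : u ∈ ζᗮ) (hu' : u ∉ ζ') :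
    ζ'.map ((𝕜 ∙ u)ᗮ.starProjection : V →ₗ[𝕜] V) ∈ S := by
  have hr : finrank 𝕜 ζ = r := hS.1 hζ
  have hr' : finrank 𝕜 ζ' = r := hS.1 hζ'
  have hu0 : u ≠ 0 := fun h => hu' (h ▸ zero_mem _)
  -- The `d`-plane will be `(U ⊔ 𝕜 ∙ u)ᗮ` with `U` orthogonal to `ζ`, `ζ'` and `u`; since `U ⟂ ζ'`,
  -- its projection acts on `ζ'` as the one along `u`.
  have hdim : finrank 𝕜 V - d - 1 ≤ finrank 𝕜 ↥(ζ ⊔ ζ' ⊔ 𝕜 ∙ u)ᗮ := by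
    have h1 := (ζ ⊔ ζ' ⊔ 𝕜 ∙ u).finrank_add_finrank_orthogonal
    have h3 := Submodule.finrank_add_le_finrank_add_finrank ζ ζ'
    have h4 := Submodule.finrank_add_le_finrank_add_finrank (ζ ⊔ ζ') (𝕜 ∙ u)
    rw [finrank_span_singleton hu0] at h4
    omega
  obtain ⟨U, -, hU, hUd⟩ := exists_between_finrank_eq
    (bot_le : ⊥ ≤ (ζ ⊔ ζ' ⊔ 𝕜 ∙ u)ᗮ) (by rw [finrank_bot]; exact Nat.zero_le _) hdim
  rw [← inf_orthogonal, ← inf_orthogonal, le_inf_iff, le_inf_iff] at hU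
  obtain ⟨⟨hUζ, hUζ'⟩, hUu⟩ := hU
  have huU : u ∈ Uᗮ := fun y hy => mem_orthogonal_singleton_iff_inner_left.1 (hUu hy)
  have huU' : u ∉ U := fun h => hu0 (inner_self_eq_zero.1 (huU u h))
  have hdimU : finrank 𝕜 ↥(U ⊔ 𝕜 ∙ u)ᗮ = d := by
    have h1 := (U ⊔ 𝕜 ∙ u).finrank_add_finrank_orthogonal
    rw [finrank_sup_span_singleton huU'] at h1
    omega
  have hEq : ∀ x ∈ ζ', (U ⊔ 𝕜 ∙ u)ᗮ.starProjection x = (𝕜 ∙ u)ᗮ.starProjection x := by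
    intro x hx
    have hmem := sub_starProjection_orthogonal_mem (𝕜 ∙ u) x
    apply eq_starProjection_of_mem_orthogonal
    · rw [← inf_orthogonal]
      refine ⟨?_, starProjection_apply_mem _ _⟩
      have hxU : x ∈ Uᗮ := fun y hy => inner_eq_zero_symm.1 (hUζ' hy x hx)
      have h1 : x - (𝕜 ∙ u)ᗮ.starProjection x ∈ Uᗮ :=
        (span_singleton_le_iff_mem _ _).2 huU hmem
      simpa using Uᗮ.sub_mem hxU h1
    · rw [orthogonal_orthogonal]
      exact (le_sup_right : 𝕜 ∙ u ≤ U ⊔ 𝕜 ∙ u) hmem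
  refine hS.2 ζ hζ ζ' hζ' _ ?_ ⟨(U ⊔ 𝕜 ∙ u)ᗮ, hdimU, ?_, ?_⟩
  · change finrank 𝕜 _ = r
    rw [finrank_map_starProjection_of_disjoint, hr']
    intro x hx hxu
    rw [orthogonal_orthogonal, mem_span_singleton] at hxu
    obtain ⟨c, rfl⟩ := hxu
    by_contra hc
    exact hu' ((ζ'.smul_mem_iff (left_ne_zero_of_smul hc)).1 hx)
  · rw [← inf_orthogonal, le_inf_iff]
    refine ⟨fun x hx y hy => inner_eq_zero_symm.1 (hUζ hy x hx), fun x hx => ?_⟩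
    rw [mem_orthogonal_singleton_iff_inner_left]
    exact hu x hx
  · ext y
    constructor
    · rintro ⟨x, hx, rfl⟩
      exact ⟨x, hx, hEq x hx⟩
    · rintro ⟨x, hx, rfl⟩
      exact ⟨x, hx, (hEq x hx).symm⟩

theorem isProjectionClosed {r d : ℕ} {S : Set (Submodule 𝕜 V)} (hS : IsSaturated r d S)
    (h2 : 2 * r ≤ d) (hd : d < finrank 𝕜 V) (H : Submodule 𝕜 V) :
    IsProjectionClosed 𝕜 {v : Hᗮ | v ≠ 0 ∧ H ⊔ 𝕜 ∙ (v : V) ∈ S} where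
  smul_mem := by
    rintro c hc v ⟨hv0, hv⟩
    refine ⟨smul_ne_zero hc hv0, ?_⟩
    rwa [Submodule.coe_smul, span_singleton_smul_eq (IsUnit.mk0 c hc)]
  proj_mem := by
    rintro a ⟨-, ha⟩ b ⟨-, hb⟩ c hc0 hac hcb
    refine ⟨hc0, ?_⟩
    by_cases hbc : b - c = 0
    · rwa [← sub_eq_zero.1 hbc]
    have hu : ((b - c : Hᗮ) : V) ∈ (H ⊔ 𝕜 ∙ (a : V))ᗮ := by
      rw [← inf_orthogonal]
      exact ⟨(b - c).2, mem_orthogonal_singleton_iff_inner_right.2 hac⟩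
    have hu' : ((b - c : Hᗮ) : V) ∉ H ⊔ 𝕜 ∙ (b : V) := by
      intro h
      obtain ⟨h', hh', y, hy, hsum⟩ := mem_sup.1 h
      obtain ⟨t, rfl⟩ := mem_span_singleton.1 hy
      have h0 : h' = 0 := by
        have : h' = ((b - c - t • b : Hᗮ) : V) := by
          push_cast at hsum ⊢
          rw [← hsum]; abel
        have h3 : h' ∈ Hᗮ := this ▸ (b - c - t • b).2
        exact inner_self_eq_zero.1 (h3 h' hh')
      have hbt : b - c = t • b := by
        apply Subtype.ext
        rw [← hsum, h0, zero_add]; rfl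
      have hc : c = (1 - t) • b := by
        rw [sub_smul, one_smul, ← hbt]; abel
      rw [hbt, hc, inner_smul_left, inner_smul_right] at hcb
      have ht : t ≠ 0 := by
        rintro rfl
        exact hbc (by rw [hbt, zero_smul])
      have hb0 : b ≠ 0 := by
        rintro rfl
        exact hc0 (by rw [hc, smul_zero])
      have h1t : 1 - t ≠ 0 := by
        intro h
        exact hc0 (by rw [hc, h, zero_smul])
      exact mul_ne_zero ((map_ne_zero _).2 h1t)
        (mul_ne_zero ht (inner_self_ne_zero.2 hb0)) hcb
    have hm := hS.map_mem h2 hd ha hb hu hu'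
    have hH : H ≤ (𝕜 ∙ ((b - c : Hᗮ) : V))ᗮ := fun x hx =>
      mem_orthogonal_singleton_iff_inner_left.2 ((b - c).2 x hx)
    have hPb : (𝕜 ∙ ((b - c : Hᗮ) : V))ᗮ.starProjection (b : V) = c := by
      apply eq_starProjection_of_mem_orthogonal
      · exact mem_orthogonal_singleton_iff_inner_left.2 hcb
      · rw [orthogonal_orthogonal]
        exact mem_span_singleton_self _
    rw [Submodule.map_sup, map_starProjection_eq_of_le hH, Submodule.map_span,
      Set.image_singleton] at hm
    simpa only [ContinuousLinearMap.coe_coe, hPb] using hm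

end IsSaturated

theorem exists_eq_sup_span_singleton {H θ : Submodule 𝕜 V} (hH : H ≤ θ)
    (hdim : finrank 𝕜 θ = finrank 𝕜 H + 1) :
    ∃ v : Hᗮ, v ≠ 0 ∧ H ⊔ 𝕜 ∙ (v : V) = θ := by
  have h1 := finrank_add_inf_finrank_orthogonal hH
  have h2 : Hᗮ ⊓ θ ≠ ⊥ := fun h => by
    rw [h, finrank_bot] at h1
    omega
  obtain ⟨v, hv, hv0⟩ := exists_mem_ne_zero_of_ne_bot h2
  refine ⟨⟨v, hv.1⟩, fun h => hv0 (congrArg Subtype.val h), ?_⟩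
  have hvH : v ∉ H := fun h => hv0 (inner_self_eq_zero.1 (hv.1 v h))
  refine eq_of_le_of_finrank_eq (sup_le hH ((span_singleton_le_iff_mem _ _).2 hv.2)) ?_
  rw [hdim, finrank_sup_span_singleton hvH]

namespace IsSaturated

/-- If `2r ≤ d`, a saturated set containing two adjacent planes contains the spine of their
intersection. -/
theorem spine_subset_of_adjacent {r d : ℕ} {S : Set (Submodule 𝕜 V)} (hS : IsSaturated r d S)
    (h2 : 2 * r ≤ d) (hd : d < finrank 𝕜 V) {H ζ ζ' : Submodule 𝕜 V} (hH : finrank 𝕜 H + 1 = r)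
    (hζ : ζ ∈ S) (hζ' : ζ' ∈ S) (hHζ : H ≤ ζ) (hHζ' : H ≤ ζ') (hne : ζ ≠ ζ') :
    spine r H ⊆ S := by
  obtain ⟨a, ha0, rfl⟩ := exists_eq_sup_span_singleton hHζ ((hS.1 hζ).trans hH.symm)
  obtain ⟨b, hb0, rfl⟩ := exists_eq_sup_span_singleton hHζ' ((hS.1 hζ').trans hH.symm)
  rintro θ ⟨hθ, hHθ⟩
  obtain ⟨v, hv0, rfl⟩ := exists_eq_sup_span_singleton hHθ (hθ.trans hH.symm)
  have hE : 3 ≤ finrank 𝕜 Hᗮ := by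
    have := H.finrank_add_finrank_orthogonal
    omega
  refine ((hS.isProjectionClosed h2 hd H).mem_of_notMem_span hE (a := a) (b := b) ⟨ha0, hζ⟩ ha0
    ⟨hb0, hζ'⟩ ?_ hv0).2
  intro h
  obtain ⟨t, rfl⟩ := mem_span_singleton.1 h
  have ht : t ≠ 0 := by
    rintro rfl
    exact hb0 (zero_smul _ _)
  apply hne
  rw [Submodule.coe_smul, span_singleton_smul_eq (IsUnit.mk0 t ht)]

/-- If `2r ≤ d` and a saturated set contains the spine of `π` and a plane not containing `π`,
then it contains the spine of a proper subspace of `π`. -/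
theorem exists_lt_spine_subset {r d : ℕ} {S : Set (Submodule 𝕜 V)} (hS : IsSaturated r d S)
    (hr : 1 ≤ r) (h2 : 2 * r ≤ d) (hd : d < finrank 𝕜 V) {ζ π : Submodule 𝕜 V} (hζ : ζ ∈ S)
    (hπr : finrank 𝕜 π ≤ r) (hπ : spine r π ⊆ S) (hπζ : ¬ π ≤ ζ) :
    ∃ π₀ < π, spine r π₀ ⊆ S := by
  have hζr : finrank 𝕜 ζ = r := hS.1 hζ
  obtain ⟨p, hp, hpζ⟩ := SetLike.not_le_iff_exists.1 hπζ
  obtain ⟨f, hf, hfp⟩ := exists_mem_orthogonal_inner_ne_zero hpζ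
  have hf0 : f ≠ 0 := by rintro rfl; simp at hfp
  have hpF : p ∉ (𝕜 ∙ f)ᗮ := fun h => hfp (mem_orthogonal_singleton_iff_inner_right.1 h)
  have hζF : ζ ≤ (𝕜 ∙ f)ᗮ := fun x hx => mem_orthogonal_singleton_iff_inner_left.2 (hf x hx)
  have hF : finrank 𝕜 (𝕜 ∙ f)ᗮ + 1 = finrank 𝕜 V := by
    have := (𝕜 ∙ f).finrank_add_finrank_orthogonal
    rw [finrank_span_singleton hf0] at this
    omega
  have hinf : ∀ W : Submodule 𝕜 V, finrank 𝕜 W ≤ finrank 𝕜 ↥(W ⊓ (𝕜 ∙ f)ᗮ) + 1 := fun W => by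
    have h1 := Submodule.finrank_sup_add_finrank_inf_eq W (𝕜 ∙ f)ᗮ
    have h3 := Submodule.finrank_le (W ⊔ (𝕜 ∙ f)ᗮ)
    omega
  have hlt : π ⊓ (𝕜 ∙ f)ᗮ < π := lt_of_le_of_ne inf_le_left fun h => hpF (h.ge hp).2
  have hlt' := Submodule.finrank_lt_finrank_of_lt hlt
  refine ⟨π ⊓ (𝕜 ∙ f)ᗮ, hlt, ?_⟩
  rintro θ ⟨hθ, hθπ⟩
  have hθ' := hinf θ
  rw [show finrank 𝕜 θ = r from hθ] at hθ'
  obtain ⟨H, hπH, hHθ, hH⟩ := exists_between_finrank_eq (le_inf hθπ inf_le_right)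
    (m := r - 1) (by omega) (by omega)
  obtain ⟨hHθ, hHF⟩ := le_inf_iff.1 hHθ
  have hHπ : H ⊓ π = π ⊓ (𝕜 ∙ f)ᗮ :=
    le_antisymm (le_inf inf_le_right (inf_le_left.trans hHF)) (le_inf hπH inf_le_left)
  have hζ'r : finrank 𝕜 ↥(H ⊔ π) = r := by
    have h1 := Submodule.finrank_sup_add_finrank_inf_eq H π
    have h3 := hinf π
    rw [hHπ] at h1
    omega
  have hζ' : H ⊔ π ∈ S := hπ ⟨hζ'r, le_sup_right⟩
  -- A direction `u ⟂ ζ, H` must move `π`, hence `H ⊔ π`, while keeping its dimension.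
  have hA1 : ¬ (ζ ⊔ H)ᗮ ≤ πᗮ := fun h =>
    hpF (sup_le hζF hHF (orthogonal_le_orthogonal_iff.1 h hp))
  have hA2 : ¬ (ζ ⊔ H)ᗮ ≤ H ⊔ π := fun h => by
    have h1 := (ζ ⊔ H).finrank_add_finrank_orthogonal
    have h3 := Submodule.finrank_add_le_finrank_add_finrank ζ H
    have h4 := Submodule.finrank_sup_add_finrank_inf_eq H (ζ ⊔ H)ᗮ
    have h5 : H ⊓ (ζ ⊔ H)ᗮ = ⊥ :=
      le_bot_iff.1 ((inf_le_inf_left _ (orthogonal_le le_sup_right)).trans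
        H.inf_orthogonal_eq_bot.le)
    have h6 := Submodule.finrank_mono (sup_le le_sup_left h : H ⊔ (ζ ⊔ H)ᗮ ≤ H ⊔ π)
    rw [h5, finrank_bot] at h4
    omega
  obtain ⟨u, hu, huπ, huζ'⟩ := exists_mem_notMem_notMem hA1 hA2
  rw [← inf_orthogonal] at hu
  have hζ₁ := hS.map_mem h2 hd hζ hζ' hu.1 huζ'
  have hHu : H ≤ (𝕜 ∙ u)ᗮ := fun x hx => mem_orthogonal_singleton_iff_inner_left.2 (hu.2 x hx)
  refine hS.spine_subset_of_adjacent h2 hd (by omega) hζ' hζ₁ le_sup_left ?_ ?_ ⟨hθ, hHθ⟩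
  · exact (map_starProjection_eq_of_le hHu).ge.trans (Submodule.map_mono le_sup_left)
  -- If `H ⊔ π` were fixed, each `x - Px` with `x ∈ π` would lie in it and on the line of `u`, hence
  -- vanish, giving `u ⟂ π`.
  · intro heq
    apply huπ
    intro x hx
    have hxζ' : x ∈ H ⊔ π := (le_sup_right : π ≤ H ⊔ π) hx
    have h1 := sub_starProjection_orthogonal_mem (𝕜 ∙ u) x
    have h3 : x - (𝕜 ∙ u)ᗮ.starProjection x ∈ H ⊔ π :=
      sub_mem hxζ' (heq.ge ⟨x, hxζ', rfl⟩)
    obtain ⟨t, ht⟩ := mem_span_singleton.1 h1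
    by_cases ht0 : t = 0
    · rw [ht0, zero_smul] at ht
      have : x ∈ (𝕜 ∙ u)ᗮ := by
        rw [sub_eq_zero.1 ht.symm]
        exact starProjection_apply_mem _ _
      exact mem_orthogonal_singleton_iff_inner_left.1 this
    · rw [← ht] at h3
      exact absurd ((Submodule.smul_mem_iff _ ht0).1 h3) huζ'

theorem eq_spine_sInf {r d : ℕ} {S : Set (Submodule 𝕜 V)} (hS : IsSaturated r d S)
    (hr : 1 ≤ r) (h2 : 2 * r ≤ d) (hd : d < finrank 𝕜 V) : S = spine r (sInf S) := by
  refine Set.Subset.antisymm (fun ζ hζ => ⟨hS.1 hζ, sInf_le hζ⟩) ?_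
  obtain rfl | ⟨ζ₀, hζ₀⟩ := S.eq_empty_or_nonempty
  · rintro θ ⟨hθ, hθ'⟩
    rw [sInf_empty, top_le_iff] at hθ'
    have : finrank 𝕜 θ = r := hθ
    rw [hθ', finrank_top] at this
    omega
  let T : Set (Submodule 𝕜 V) := {π | finrank 𝕜 π ≤ r ∧ spine r π ⊆ S}
  have hT : T.Nonempty := by
    refine ⟨ζ₀, (hS.1 hζ₀).le, ?_⟩
    rintro θ ⟨hθ, hle⟩
    rwa [← eq_of_le_of_finrank_eq hle ((hS.1 hζ₀).trans hθ.symm)]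
  obtain ⟨π, ⟨hπr, hπ⟩, hmin⟩ := wellFounded_lt.has_min T hT
  rintro θ ⟨hθ, hle⟩
  refine hπ ⟨hθ, le_trans (le_sInf fun ζ hζ => ?_) hle⟩
  by_contra hπζ
  obtain ⟨π₀, hlt, h0⟩ := hS.exists_lt_spine_subset hr h2 hd hζ hπr hπ hπζ
  exact hmin π₀ ⟨(Submodule.finrank_mono hlt.le).trans hπr, h0⟩ hlt

end IsSaturated

/-! ### Properties of spines. -/

theorem isSaturated_spine (r d : ℕ) (K : Submodule 𝕜 V) : IsSaturated r d (spine r K) := by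
  refine ⟨fun W hW => hW.1, ?_⟩
  rintro ζ hζ ζ' hζ' ζ'' hζ'' ⟨π, -, hπ, rfl⟩
  exact ⟨hζ'', (map_starProjection_eq_of_le (hζ.2.trans hπ)).ge.trans (Submodule.map_mono hζ'.2)⟩

theorem spine_nonempty {r : ℕ} {K : Submodule 𝕜 V} (hK : finrank 𝕜 K ≤ r)
    (hr : r ≤ finrank 𝕜 V) : (spine r K).Nonempty := by
  obtain ⟨W, hKW, -, hW⟩ := exists_between_finrank_eq (le_top : K ≤ ⊤) hK (by rwa [finrank_top])
  exact ⟨W, hW, hKW⟩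

theorem sInf_spine {r : ℕ} {K : Submodule 𝕜 V} (hK : finrank 𝕜 K ≤ r)
    (hr : r < finrank 𝕜 V) : sInf (spine r K) = K := by
  refine le_antisymm (fun v hv => ?_) (le_sInf fun W hW => hW.2)
  by_contra hvK
  obtain ⟨f, hf, hfv⟩ := exists_mem_orthogonal_inner_ne_zero hvK
  have hf0 : f ≠ 0 := by rintro rfl; simp at hfv
  have hKF : K ≤ (𝕜 ∙ f)ᗮ := fun x hx => mem_orthogonal_singleton_iff_inner_left.2 (hf x hx)
  have hF := (𝕜 ∙ f).finrank_add_finrank_orthogonal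
  rw [finrank_span_singleton hf0] at hF
  obtain ⟨W, hKW, hWF, hW⟩ := exists_between_finrank_eq hKF hK (by omega)
  have hvW : v ∈ W := (mem_sInf.1 hv) W ⟨hW, hKW⟩
  exact hfv (mem_orthogonal_singleton_iff_inner_right.1 (hWF hvW))

/-- Given two members, a vector outside both, added to an `(r-1)`-plane through `K`, spans a third.
-/
theorem spine_ncard_ne_two {r : ℕ} (hr : r < finrank 𝕜 V) (K : Submodule 𝕜 V) :
    (spine r K).ncard ≠ 2 := by
  intro h
  obtain ⟨x, y, hxy, hS⟩ := Set.ncard_eq_two.1 h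
  have hx : x ∈ spine r K := hS ▸ Set.mem_insert x _
  have hy : y ∈ spine r K := hS ▸ Set.mem_insert_of_mem x rfl
  have hxr : finrank 𝕜 x = r := hx.1
  have hyr : finrank 𝕜 y = r := hy.1
  have hKx : finrank 𝕜 K < r := by
    refine lt_of_le_of_ne (hxr ▸ Submodule.finrank_mono hx.2) fun hK => hxy ?_
    rw [← eq_of_le_of_finrank_eq hx.2 (hK.trans hxr.symm),
      ← eq_of_le_of_finrank_eq hy.2 (hK.trans hyr.symm)]
  obtain ⟨M, hKM, hMx, hM⟩ := exists_between_finrank_eq hx.2 (m := r - 1) (by omega) (by omega)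
  have hproper : ∀ W : Submodule 𝕜 V, finrank 𝕜 W = r → ¬ ⊤ ≤ W := fun W hW h => by
    rw [top_le_iff.1 h, finrank_top] at hW
    omega
  obtain ⟨v, -, hvx, hvy⟩ := exists_mem_notMem_notMem (hproper x hxr) (hproper y hyr)
  have hvM : v ∈ M ⊔ 𝕜 ∙ v := (le_sup_right : 𝕜 ∙ v ≤ M ⊔ 𝕜 ∙ v) (mem_span_singleton_self v)
  have hmem : M ⊔ 𝕜 ∙ v ∈ spine r K := by
    refine ⟨?_, hKM.trans le_sup_left⟩
    change finrank 𝕜 _ = r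
    rw [finrank_sup_span_singleton fun h => hvx (hMx h)]
    omega
  rw [hS] at hmem
  rcases hmem with h | h
  · exact hvx (h ▸ hvM)
  · exact hvy (Set.mem_singleton_iff.1 h ▸ hvM)

/-! ### Two-element saturated sets for `d < 2r`. -/

/-- If `d < 2r`, no `r`-plane arises by projecting `ζ'` to a `d`-plane through `ζ` when `ζ'` is
comparable with the orthogonal complement of `ζ`. -/
theorem not_tau_of_comparable_orthogonal {r d : ℕ} (h2 : d < 2 * r) (hd : d < finrank 𝕜 V)
    {ζ ζ' ζ'' : Submodule 𝕜 V} (hζ : finrank 𝕜 ζ = r) (hζ' : finrank 𝕜 ζ' = r)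
    (hζ'' : finrank 𝕜 ζ'' = r) (h : ζ' ≤ ζᗮ ∨ ζᗮ ≤ ζ') : ¬ Tau d ζ ζ' ζ'' := by
  rintro ⟨π, hπ, hζπ, rfl⟩
  have hπd : finrank 𝕜 π = d := hπ
  have hπ' := π.finrank_add_finrank_orthogonal
  have hle : πᗮ ≤ ζᗮ := orthogonal_le hζπ
  -- Either both lie in `ζᗮ` and `r + (n - d) > n - r`, or `πᗮ ≤ ζ'` with `πᗮ` nonzero as `d < n`.
  have hne : ζ' ⊓ πᗮ ≠ ⊥ := by
    intro hbot
    rcases h with h | h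
    · have h1 := Submodule.finrank_sup_add_finrank_inf_eq ζ' πᗮ
      have h3 := Submodule.finrank_mono (sup_le h hle)
      have h4 := ζ.finrank_add_finrank_orthogonal
      rw [hbot, finrank_bot] at h1
      omega
    · rw [inf_eq_right.2 (hle.trans h)] at hbot
      rw [hbot, finrank_bot] at hπ'
      omega
  have := finrank_map_starProjection_lt hne
  omega

theorem exists_isSaturated_ncard_eq_two {r d : ℕ} (hr : 1 ≤ r) (hrd : r < d) (h2 : d < 2 * r)
    (hd : d < finrank 𝕜 V) : ∃ S : Set (Submodule 𝕜 V), IsSaturated r d S ∧ S.ncard = 2 := by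
  obtain ⟨ζ, -, -, hζ⟩ := exists_between_finrank_eq (bot_le : (⊥ : Submodule 𝕜 V) ≤ ⊤) (m := r)
    (by rw [finrank_bot]; omega) (by rw [finrank_top]; omega)
  have hζ1 := ζ.finrank_add_finrank_orthogonal
  obtain ⟨ζ', hζ', hc⟩ : ∃ ζ' : Submodule 𝕜 V, finrank 𝕜 ζ' = r ∧ (ζ' ≤ ζᗮ ∨ ζᗮ ≤ ζ') := by
    rcases le_total r (finrank 𝕜 ζᗮ) with h | h
    · obtain ⟨W, -, hW, hWr⟩ := exists_between_finrank_eq (bot_le : ⊥ ≤ ζᗮ)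
        (by rw [finrank_bot]; omega) h
      exact ⟨W, hWr, Or.inl hW⟩
    · obtain ⟨W, hW, -, hWr⟩ := exists_between_finrank_eq (le_top : ζᗮ ≤ ⊤) h
        (by rw [finrank_top]; omega)
      exact ⟨W, hWr, Or.inr hW⟩
  have hc' : ζ ≤ ζ'ᗮ ∨ ζ'ᗮ ≤ ζ := by
    refine hc.imp (fun h => ?_) (fun h => ?_)
    · simpa using orthogonal_le h
    · simpa using orthogonal_le h
  have hne : ζ ≠ ζ' := by
    rintro rfl
    rcases hc with h | h
    · have := ζ.inf_orthogonal_eq_bot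
      rw [inf_eq_left.2 h] at this
      rw [this, finrank_bot] at hζ
      omega
    · have := ζ.inf_orthogonal_eq_bot
      rw [inf_eq_right.2 h] at this
      rw [this, finrank_bot] at hζ1
      omega
  refine ⟨{ζ, ζ'}, ⟨?_, ?_⟩, Set.ncard_pair hne⟩
  · rintro W (rfl | rfl)
    exacts [hζ, hζ']
  · have hself : ∀ W W' : Submodule 𝕜 V, Tau d W W W' → W' = W := by
      rintro W _ ⟨π, -, hπ, rfl⟩
      exact map_starProjection_eq_of_le hπ
    rintro a (rfl | rfl) b (rfl | rfl) c hcr ht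
    · exact Or.inl (hself _ _ ht)
    · exact absurd ht (not_tau_of_comparable_orthogonal h2 hd hζ hζ' hcr hc)
    · exact absurd ht (not_tau_of_comparable_orthogonal h2 hd hζ' hζ hcr hc')
    · exact Or.inr (hself _ _ ht)

end GrassmannianSpines

theorem mainTheorem1 {𝕜 : Type*} [RCLike 𝕜] {V : Type*} [NormedAddCommGroup V]
    [InnerProductSpace 𝕜 V] [FiniteDimensional 𝕜 V] (r d n : ℕ)
    (hr : 1 ≤ r) (hrd : r < d) (hdn : d < n) (hn : 3 ≤ n) (hV : Module.finrank 𝕜 V = n) :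
    List.TFAE
      [ 2 * r ≤ d,
        ∀ S : Set (Submodule 𝕜 V), GrassmannianSpines.IsSaturated r d S →
          S = GrassmannianSpines.spine r (sInf S),
        ¬ ∃ S : Set (Submodule 𝕜 V), GrassmannianSpines.IsSaturated r d S ∧ S.ncard = 2 ] ∧
    ((∀ S : Set (Submodule 𝕜 V), GrassmannianSpines.IsSaturated r d S →
          S = GrassmannianSpines.spine r (sInf S)) →
      Set.BijOn (GrassmannianSpines.spine r) (GrassmannianSpines.grassmannianLE 𝕜 V r)
        {S : Set (Submodule 𝕜 V) | GrassmannianSpines.IsSaturated r d S ∧ S.Nonempty}) := by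
  subst hV
  constructor
  · tfae_have 1 → 2 := fun h2 S hS => hS.eq_spine_sInf hr h2 hdn
    tfae_have 2 → 3 := by
      rintro h ⟨S, hS, hcard⟩
      rw [h S hS] at hcard
      exact GrassmannianSpines.spine_ncard_ne_two (hrd.trans hdn) _ hcard
    tfae_have 3 → 1 := by
      intro h
      by_contra h2
      exact h (GrassmannianSpines.exists_isSaturated_ncard_eq_two hr hrd (not_le.1 h2) hdn)
    tfae_finish
  · intro h
    refine ⟨fun K hK => ⟨GrassmannianSpines.isSaturated_spine r d K,
      GrassmannianSpines.spine_nonempty hK (hrd.trans hdn).le⟩, fun K hK K' hK' heq => ?_, ?_⟩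
    · rw [← GrassmannianSpines.sInf_spine hK (hrd.trans hdn), heq,
        GrassmannianSpines.sInf_spine hK' (hrd.trans hdn)]
    · rintro S ⟨hS, ζ, hζ⟩
      exact ⟨sInf S, (Submodule.finrank_mono (sInf_le hζ)).trans (hS.1 hζ).le, (h S hS).symm⟩
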